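/- For a bounded open convex set $\mathcal C\subset\mathbb R^n$, $x\in\mathcal C$ and $v\in\mathbb R^n\setminus\{0\}$, let $x^{+}$ and $x^{-}$ be the points where the half-lines from $x$ in the directions $v$ and $-v$ meet $\partial\mathcal C$, and set $$F_{\mathcal C}(x,v)=\tfrac12\|v\|\Bigl(\frac1{\|x-x^-\|}+\frac1{\|x-x^+\|}\Bigr),\qquad F_{\mathcal C}(x,0)=0$$ (Euclidean norm); this is the Finsler metric of the Hilbert geometry of $\mathcal C$. For a nondegenerate $n$-simplex $P$ in $\mathbb R^n$ let $\overline P$ be the closed simplex and $F_P$ the Finsler metric of its interior. Lemma. Let $\overline{\mathcal S}\subset\overline{\mathcal C_1}\subset\overline{\mathcal C_2}$ be three nondegenerate $n$-simplices in $\mathbb R^n$ that meet only along common faces $\mathcal F_0,\dots,\mathcal F_{n-1}$ of $\mathcal S$, one in each dimension, in the following sense (all faces are closed): 1. for each $0\le k\le n-1$, $\mathcal F_k$ is a $k$-dimensional face of $\mathcal S$ that is contained in a $k$-dimensional face of $\mathcal C_1$ and in a $k$-dimensional face of $\mathcal C_2$; 2. for every proper face $A$ of $\mathcal C_1$, the set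 $A\cap\overline{\mathcal S}$ is either empty or equal to one of the faces $\mathcal F_0,\dots,\mathcal F_{n-1}$. (The main case is a flag $\mathcal F_0\subset\mathcal F_1\subset\dots\subset\mathcal F_{n-1}$, but this nesting is not required.) Then there is a constant $M$ such that $$F_{\mathcal C_2}(x,v)\le F_{\mathcal C_1}(x,v)\le M\,F_{\mathcal C_2}(x,v)$$ for all $x\in\overline{\mathcal S}$ lying in the interior of $\mathcal C_1$ (in particular for all $x$ in the interior of $\mathcal S$) and all $v\in\mathbb R^n$. -/

import Mathlib

open Set

noncomputable section

namespace HilbertSimplex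

/-- The point where the half-line from `p` in the direction `v` leaves `C`. For a bounded open convex
set `C`, `p ∈ C` and `v ≠ 0` it is the boundary point `p⁺` (see `frontier_inter_ray`). -/
def exitPoint {E : Type*} [NormedAddCommGroup E] [NormedSpace ℝ E] (C : Set E) (p v : E) : E :=
  p + sSup {t : ℝ | p + t • v ∈ C} • v

open scoped Classical in
/-- The Finsler metric of the Hilbert geometry of `C`:
`F_C(p, v) = ½ ‖v‖ (1 / ‖p - p⁻‖ + 1 / ‖p - p⁺‖)` for `v ≠ 0`, and `F_C(p, 0) = 0`. -/
def hilbertFinsler {E : Type*} [NormedAddCommGroup E] [NormedSpace ℝ E]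
    (C : Set E) (p v : E) : ℝ :=
  if v = 0 then 0
  else 1 / 2 * ‖v‖ * (1 / ‖p - exitPoint C p (-v)‖ + 1 / ‖p - exitPoint C p v‖)

/-- The closed simplex with the vertices of `P`. -/
def closedSimplex {n : ℕ} (P : Affine.Simplex ℝ (EuclideanSpace ℝ (Fin n)) n) :
    Set (EuclideanSpace ℝ (Fin n)) :=
  convexHull ℝ (Set.range P.points)

/-- The open simplex with the vertices of `P`, a bounded open convex set. -/
def openSimplex {n : ℕ} (P : Affine.Simplex ℝ (EuclideanSpace ℝ (Fin n)) n) :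
    Set (EuclideanSpace ℝ (Fin n)) :=
  interior (closedSimplex P)

/-- The closed face of `P` spanned by the vertices with index in `J`; its dimension is
`J.card - 1` (and it is empty for `J = ∅`). -/
def closedFace {n : ℕ} (P : Affine.Simplex ℝ (EuclideanSpace ℝ (Fin n)) n)
    (J : Finset (Fin (n + 1))) : Set (EuclideanSpace ℝ (Fin n)) :=
  convexHull ℝ (P.points '' (J : Set (Fin (n + 1))))

/-- For a bounded open convex set the open half-line from `p` along `v` meets the boundary exactly
in `exitPoint C p v`. -/
theorem frontier_inter_ray {E : Type*} [NormedAddCommGroup E] [NormedSpace ℝ E] {C : Set E}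
    (hb : Bornology.IsBounded C) (ho : IsOpen C) (hc : Convex ℝ C) {p v : E} (hp : p ∈ C)
    (hv : v ≠ 0) :
    frontier C ∩ {x | ∃ t : ℝ, 0 < t ∧ x = p + t • v} = {exitPoint C p v} := by
  set T : Set ℝ := {t : ℝ | p + t • v ∈ C} with hT
  have hcont : Continuous fun t : ℝ => p + t • v := by fun_prop
  have hTo : IsOpen T := ho.preimage hcont
  have h0 : (0 : ℝ) ∈ T := by simpa [hT] using hp
  have hvn : 0 < ‖v‖ := norm_pos_iff.2 hv
  have hbdd : BddAbove T := by
    obtain ⟨R, hR⟩ := hb.exists_norm_le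
    refine ⟨(R + ‖p‖) / ‖v‖, fun t ht => ?_⟩
    rw [le_div_iff₀ hvn]
    have h1 := hR _ ht
    have h2 : ‖t • v‖ ≤ ‖p + t • v‖ + ‖p‖ := by
      have := norm_sub_le (p + t • v) p
      simpa using this
    rw [norm_smul, Real.norm_eq_abs] at h2
    nlinarith [le_abs_self t]
  have hlub : IsLUB T (sSup T) := isLUB_csSup ⟨0, h0⟩ hbdd
  have hnot : sSup T ∉ T := by
    intro h
    obtain ⟨ε, hε, hball⟩ := Metric.isOpen_iff.1 hTo _ h
    have : sSup T + ε / 2 ∈ T := hball (by simp [abs_of_pos hε]; linarith)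
    linarith [hlub.1 this]
  have hpos : 0 < sSup T :=
    lt_of_le_of_ne (hlub.1 h0) (fun h => hnot (h ▸ h0))
  have hcl : exitPoint C p v ∈ closure C := by
    have h1 : sSup T ∈ closure T := hlub.mem_closure ⟨0, h0⟩
    exact map_mem_closure (f := fun t : ℝ => p + t • v) hcont h1 (fun t ht => ht)
  have hseg : ∀ s t : ℝ, 0 < t → t < s → p + s • v ∈ closure C → t ∈ T := by
    intro s t ht hts hs
    have hs0 : 0 < s := ht.trans hts
    have hsub := hc.openSegment_interior_closure_subset_interior
      (x := p) (y := p + s • v) (by rwa [ho.interior_eq]) hs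
    rw [ho.interior_eq] at hsub
    refine hsub ⟨1 - t / s, t / s, ?_, by positivity, by ring, ?_⟩
    · have := (div_lt_one hs0).2 hts
      linarith
    · have hst : t / s * s = t := div_mul_cancel₀ _ hs0.ne'
      rw [smul_add, smul_smul, hst, ← add_assoc, ← add_smul]
      simp
  ext x
  simp only [mem_inter_iff, mem_ofPred_eq, mem_singleton_iff, ho.frontier_eq, mem_sdiff]
  constructor
  · rintro ⟨⟨hx1, hx2⟩, t, ht, rfl⟩
    have htT : t ∉ T := hx2
    have : t = sSup T := by
      rcases lt_trichotomy t (sSup T) with h | h | h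
      · exact absurd (hseg _ _ ht h hcl) htT
      · exact h
      · exact absurd (hseg _ _ hpos h hx1) hnot
    rw [exitPoint, this]
  · rintro rfl
    exact ⟨⟨hcl, hnot⟩, _, hpos, rfl⟩

end HilbertSimplex

end

/-! The metric at `x` is half the sum of the inverse exit times along `v` and `-v`. Enlarging the
domain lengthens exit times, which gives the first inequality (`hilbertFinsler_anti`). For the
second, let `λ_i`, `μ_j` be the barycentric coordinates of `C₁`, `C₂`, let `c_j` be the vertices of
`C₂`, and let `R` be the sum of the two inverse exit times from `C₂`. Then `|μ_j(v)| ≤ R μ_j(x)` for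
the linear parts, and `λ_i = ∑ λ_i(c_j) μ_j`. It therefore suffices that `|λ_i(c_j)| μ_j ≤ K λ_i` on
`S`. By affinity this holds for some `K` once the left side vanishes at each vertex of `S` where
`λ_i` does (`exists_abs_le_mul`). Such a vertex lies in some `F k`, on which `λ_i = 0`, and `F k`
spans the same flat as a face of `C₂` (`affineSpan_face_eq`): if `c_j` is in that face then
`λ_i(c_j) = 0`, otherwise `μ_j = 0` on `F k`. -/

namespace HilbertSimplex

/-! ### Exit times and the Finsler metric. -/

section Ray

variable {E : Type*} [NormedAddCommGroup E] [NormedSpace ℝ E] {C D : Set E} {p v : E}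

/-- The time at which the half-line from `p` along `v` leaves `C`. -/
noncomputable def exitTime (C : Set E) (p v : E) : ℝ :=
  sSup {t : ℝ | p + t • v ∈ C}

theorem bddAbove_ray (hb : Bornology.IsBounded C) (hv : v ≠ 0) :
    BddAbove {t : ℝ | p + t • v ∈ C} := by
  have hvn : 0 < ‖v‖ := norm_pos_iff.2 hv
  obtain ⟨R, hR⟩ := hb.exists_norm_le
  refine ⟨(R + ‖p‖) / ‖v‖, fun t ht => ?_⟩
  rw [le_div_iff₀ hvn]
  have h1 := hR _ ht
  have h2 : ‖t • v‖ ≤ ‖p + t • v‖ + ‖p‖ := by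
    simpa using norm_sub_le (p + t • v) p
  rw [norm_smul, Real.norm_eq_abs] at h2
  nlinarith [le_abs_self t]

theorem le_exitTime (hb : Bornology.IsBounded C) (hv : v ≠ 0) {t : ℝ} (ht : p + t • v ∈ C) :
    t ≤ exitTime C p v :=
  le_csSup (bddAbove_ray hb hv) ht

theorem exitTime_pos (hb : Bornology.IsBounded C) (ho : IsOpen C) (hp : p ∈ C) (hv : v ≠ 0) :
    0 < exitTime C p v := by
  have hT : IsOpen {t : ℝ | p + t • v ∈ C} :=
    ho.preimage (f := fun t : ℝ => p + t • v) (by fun_prop)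
  obtain ⟨ε, hε, hball⟩ := Metric.isOpen_iff.1 hT 0 (by simpa using hp)
  have h : ε / 2 ∈ {t : ℝ | p + t • v ∈ C} :=
    hball (by rw [Metric.mem_ball, dist_zero_right, Real.norm_eq_abs, abs_of_pos] <;> linarith)
  linarith [le_exitTime hb hv h]

theorem exitTime_mono (hD : Bornology.IsBounded D) (hCD : C ⊆ D) (hp : p ∈ C) (hv : v ≠ 0) :
    exitTime C p v ≤ exitTime D p v :=
  csSup_le_csSup (bddAbove_ray hD hv) ⟨0, by simpa using hp⟩ fun _ ht => hCD ht

/-- The distance to an exit point is the exit time times `‖v‖`, so the norms cancel. -/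
theorem hilbertFinsler_eq (hb : Bornology.IsBounded C) (ho : IsOpen C) (hp : p ∈ C)
    (hv : v ≠ 0) :
    hilbertFinsler C p v = 1 / 2 * ((exitTime C p (-v))⁻¹ + (exitTime C p v)⁻¹) := by
  have hvn : ‖v‖ ≠ 0 := norm_ne_zero_iff.2 hv
  have key : ∀ w : E, w ≠ 0 → ‖p - exitPoint C p w‖ = exitTime C p w * ‖w‖ := by
    intro w hw
    have h : p - exitPoint C p w = -(exitTime C p w • w) := by
      simp [exitPoint, exitTime]
    rw [h, norm_neg, norm_smul, Real.norm_eq_abs, abs_of_pos (exitTime_pos hb ho hp hw)]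
  have h1 := (exitTime_pos hb ho hp hv).ne'
  have h2 := (exitTime_pos hb ho hp (neg_ne_zero.2 hv)).ne'
  rw [hilbertFinsler, if_neg hv, key v hv, key (-v) (neg_ne_zero.2 hv), norm_neg]
  field_simp

theorem hilbertFinsler_anti (hC : Bornology.IsBounded C) (hCo : IsOpen C)
    (hD : Bornology.IsBounded D) (hDo : IsOpen D) (hCD : C ⊆ D) (hp : p ∈ C) :
    hilbertFinsler D p v ≤ hilbertFinsler C p v := by
  by_cases hv : v = 0
  · simp [hilbertFinsler, hv]
  have hv' := neg_ne_zero.2 hv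
  rw [hilbertFinsler_eq hC hCo hp hv, hilbertFinsler_eq hD hDo (hCD hp) hv]
  have h1 := inv_anti₀ (exitTime_pos hC hCo hp hv) (exitTime_mono hD hCD hp hv)
  have h2 := inv_anti₀ (exitTime_pos hC hCo hp hv') (exitTime_mono hD hCD hp hv')
  linarith

end Ray

theorem affineMap_add_smul {E : Type*} [NormedAddCommGroup E] [NormedSpace ℝ E] (f : E →ᵃ[ℝ] ℝ)
    (p v : E) (t : ℝ) : f (p + t • v) = f p + t * f.linear v := by
  have h := f.map_vadd p (t • v)
  rw [vadd_eq_add, vadd_eq_add, map_smul, smul_eq_mul] at h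
  rw [add_comm p, h, add_comm]

/-! ### Barycentric coordinates, faces and exit times of simplices. -/

section Simplex

variable {n : ℕ} (P : Affine.Simplex ℝ (EuclideanSpace ℝ (Fin n)) n)

/-- The vertices of a full-dimensional simplex as an affine basis. -/
noncomputable def vertexBasis : AffineBasis (Fin (n + 1)) ℝ (EuclideanSpace ℝ (Fin n)) where
  toFun := P.points
  ind' := P.independent
  tot' := P.independent.affineSpan_eq_top_iff_card_eq_finrank_add_one.2 (by simp)

/-- The barycentric coordinates with respect to the vertices of `P`. -/
noncomputable def bary (i : Fin (n + 1)) : EuclideanSpace ℝ (Fin n) →ᵃ[ℝ] ℝ :=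
  (vertexBasis P).coord i

theorem coe_vertexBasis : ⇑(vertexBasis P) = P.points := rfl

theorem bary_points_of_ne {i j : Fin (n + 1)} (h : i ≠ j) : bary P i (P.points j) = 0 :=
  (vertexBasis P).coord_apply_ne h

theorem mem_closedSimplex {x : EuclideanSpace ℝ (Fin n)} :
    x ∈ closedSimplex P ↔ ∀ i, 0 ≤ bary P i x := by
  have h := (vertexBasis P).convexHull_eq_nonneg_coord
  rw [coe_vertexBasis] at h
  rw [closedSimplex, h]
  rfl

theorem mem_openSimplex {x : EuclideanSpace ℝ (Fin n)} :
    x ∈ openSimplex P ↔ ∀ i, 0 < bary P i x := by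
  have h := (vertexBasis P).interior_convexHull
  rw [coe_vertexBasis] at h
  rw [openSimplex, closedSimplex, h]
  rfl

theorem isBounded_openSimplex : Bornology.IsBounded (openSimplex P) :=
  ((isBounded_convexHull.2 (Set.finite_range P.points).isBounded).subset interior_subset)

theorem isOpen_openSimplex : IsOpen (openSimplex P) := isOpen_interior

theorem sum_bary (x : EuclideanSpace ℝ (Fin n)) : ∑ i, bary P i x = 1 :=
  (vertexBasis P).sum_coord_apply_eq_one x

theorem sum_bary_smul (x : EuclideanSpace ℝ (Fin n)) : ∑ i, bary P i x • P.points i = x :=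
  (vertexBasis P).linear_combination_coord_eq_self x

theorem points_mem_closedSimplex (i : Fin (n + 1)) : P.points i ∈ closedSimplex P :=
  subset_convexHull ℝ _ (Set.mem_range_self i)

/-- An affine function is interpolated from its values at the vertices. -/
theorem apply_eq_sum_bary (f : EuclideanSpace ℝ (Fin n) →ᵃ[ℝ] ℝ) (x : EuclideanSpace ℝ (Fin n)) :
    f x = ∑ j, bary P j x * f (P.points j) := by
  have h := Finset.univ.map_affineCombination P.points (fun j => bary P j x) (sum_bary P x) f
  rw [Finset.affineCombination_eq_linear_combination _ _ _ (sum_bary P x),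
    Finset.affineCombination_eq_linear_combination _ _ _ (sum_bary P x), sum_bary_smul] at h
  simpa using h

theorem linear_eq_sum_bary (f : EuclideanSpace ℝ (Fin n) →ᵃ[ℝ] ℝ) (v : EuclideanSpace ℝ (Fin n)) :
    f.linear v = ∑ j, (bary P j).linear v * f (P.points j) := by
  have h0 := apply_eq_sum_bary P f 0
  have h1 := apply_eq_sum_bary P f (0 + (1 : ℝ) • v)
  simp only [affineMap_add_smul, one_mul, add_mul, Finset.sum_add_distrib] at h1
  linarith

/-- A nonnegative affine function on a simplex dominates, up to a factor, every affine function
that vanishes at those vertices where it vanishes. -/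
theorem exists_abs_le_mul (f g : EuclideanSpace ℝ (Fin n) →ᵃ[ℝ] ℝ)
    (hf : ∀ m, 0 ≤ f (P.points m)) (hfg : ∀ m, f (P.points m) = 0 → g (P.points m) = 0) :
    ∃ K : ℝ, 0 ≤ K ∧ ∀ x ∈ closedSimplex P, |g x| ≤ K * f x := by
  have hq : ∀ m, 0 ≤ |g (P.points m)| / f (P.points m) :=
    fun m => div_nonneg (abs_nonneg _) (hf m)
  -- Vertices with `f = 0` contribute `0` here, since division by zero gives zero.
  set K := ∑ m, |g (P.points m)| / f (P.points m) with hK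
  refine ⟨K, Finset.sum_nonneg fun m _ => hq m, fun x hx => ?_⟩
  have hvert : ∀ m, |g (P.points m)| ≤ K * f (P.points m) := by
    intro m
    rcases (hf m).eq_or_lt with h | h
    · simp [hfg m h.symm, ← h]
    · rw [← div_le_iff₀ h]
      exact Finset.single_le_sum (fun m _ => hq m) (Finset.mem_univ m)
  rw [apply_eq_sum_bary P g x, apply_eq_sum_bary P f x, Finset.mul_sum]
  refine (Finset.abs_sum_le_sum_abs _ _).trans (Finset.sum_le_sum fun m _ => ?_)
  have h0 := (mem_closedSimplex P).1 hx m
  rw [abs_mul, abs_of_nonneg h0]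
  nlinarith [mul_le_mul_of_nonneg_left (hvert m) h0]

theorem closedFace_subset_affineSpan (J : Finset (Fin (n + 1))) :
    closedFace P J ⊆ affineSpan ℝ (P.points '' (J : Set (Fin (n + 1)))) :=
  convexHull_subset_affineSpan _

theorem affineMap_eq_zero_of_mem_affineSpan (f : EuclideanSpace ℝ (Fin n) →ᵃ[ℝ] ℝ)
    {s : Set (EuclideanSpace ℝ (Fin n))} (hs : ∀ y ∈ s, f y = 0)
    {x : EuclideanSpace ℝ (Fin n)} (hx : x ∈ affineSpan ℝ s) : f x = 0 := by
  have hle : affineSpan ℝ s ≤ (AffineSubspace.mk' (0 : ℝ) ⊥).comap f :=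
    affineSpan_le.2 fun y hy => by simp [hs y hy]
  simpa using hle hx

theorem bary_eq_zero_of_mem_closedFace {J : Finset (Fin (n + 1))} {i : Fin (n + 1)} (hi : i ∉ J)
    {x : EuclideanSpace ℝ (Fin n)} (hx : x ∈ closedFace P J) : bary P i x = 0 := by
  refine affineMap_eq_zero_of_mem_affineSpan _ ?_ (closedFace_subset_affineSpan P J hx)
  rintro _ ⟨j, hj, rfl⟩
  exact bary_points_of_ne P fun h => hi (h ▸ hj)

theorem mem_closedFace_erase {i : Fin (n + 1)} {x : EuclideanSpace ℝ (Fin n)}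
    (hx : x ∈ closedSimplex P) (hi : bary P i x = 0) :
    x ∈ closedFace P (Finset.univ.erase i) := by
  have h1 : ∑ j ∈ Finset.univ.erase i, bary P j x = 1 := by
    rw [← sum_bary P x]
    exact Finset.sum_erase _ hi
  have h2 : ∑ j ∈ Finset.univ.erase i, bary P j x • P.points j = x := by
    rw [Finset.sum_erase _ (by rw [hi, zero_smul]), sum_bary_smul]
  rw [← h2]
  exact (convex_convexHull ℝ _).sum_mem (fun j _ => (mem_closedSimplex P).1 hx j) h1
    fun j hj => subset_convexHull ℝ _ ⟨j, hj, rfl⟩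

/-- A face contained in a face of the same dimension of another simplex spans the same flat. -/
theorem affineSpan_face_eq {Q : Affine.Simplex ℝ (EuclideanSpace ℝ (Fin n)) n}
    {I J : Finset (Fin (n + 1))} {k : ℕ} (hI : I.card = k + 1) (hJ : J.card = k + 1)
    (h : closedFace P I ⊆ closedFace Q J) :
    affineSpan ℝ (P.points '' (I : Set (Fin (n + 1)))) =
      affineSpan ℝ (Q.points '' (J : Set (Fin (n + 1)))) := by
  classical
  have hle : affineSpan ℝ (P.points '' (I : Set (Fin (n + 1)))) ≤
      affineSpan ℝ (Q.points '' (J : Set (Fin (n + 1)))) :=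
    affineSpan_le.2 (((subset_convexHull ℝ _).trans h).trans (closedFace_subset_affineSpan Q J))
  have hQ : Module.finrank ℝ (affineSpan ℝ (Q.points '' (J : Set (Fin (n + 1))))).direction = k := by
    rw [direction_affineSpan, ← Finset.coe_image]
    exact Q.independent.finrank_vectorSpan_image_finset hJ
  -- `k + 1` affinely independent points in a `k`-dimensional flat span it.
  have hspan := P.independent.affineSpan_image_finset_eq_of_le_of_card_eq_finrank_add_one
    (s := I) (sp := affineSpan ℝ (Q.points '' (J : Set (Fin (n + 1)))))
    (by rwa [Finset.coe_image]) (by rw [hI, hQ])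
  rwa [Finset.coe_image] at hspan

variable {P} in
/-- The rate of decrease of a barycentric coordinate along a ray is controlled by the exit time. -/
theorem neg_linear_bary_le {x v : EuclideanSpace ℝ (Fin n)} (hx : x ∈ openSimplex P) (hv : v ≠ 0)
    (j : Fin (n + 1)) :
    -(bary P j).linear v ≤ bary P j x * (exitTime (openSimplex P) x v)⁻¹ := by
  have hT := exitTime_pos (isBounded_openSimplex P) (isOpen_openSimplex P) hx hv
  have hμ := (mem_openSimplex P).1 hx j
  rcases le_or_gt 0 ((bary P j).linear v) with h | h
  · have : 0 ≤ bary P j x * (exitTime (openSimplex P) x v)⁻¹ := by positivity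
    linarith
  · have hle : exitTime (openSimplex P) x v ≤ bary P j x / -(bary P j).linear v := by
      refine csSup_le ⟨0, by simpa using hx⟩ fun t ht => ?_
      have h1 := (mem_openSimplex P).1 ht j
      rw [affineMap_add_smul] at h1
      rw [le_div_iff₀ (by linarith)]
      linarith
    rw [le_div_iff₀ (by linarith)] at hle
    rw [← div_eq_mul_inv, le_div_iff₀ hT]
    linarith

-- For `0 < t < 1 / A` no coordinate can lose all of its value, so the ray is still inside at time
-- `t`.
variable {P} in
theorem inv_exitTime_le {x v : EuclideanSpace ℝ (Fin n)} (hx : x ∈ openSimplex P) (hv : v ≠ 0)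
    {A : ℝ} (hA : 0 < A) (h : ∀ i, |(bary P i).linear v| ≤ A * bary P i x) :
    (exitTime (openSimplex P) x v)⁻¹ ≤ A := by
  refine inv_le_of_inv_le₀ hA (le_of_forall_lt_imp_le_of_dense fun t ht => ?_)
  have hT := exitTime_pos (isBounded_openSimplex P) (isOpen_openSimplex P) hx hv
  rcases le_or_gt t 0 with h0 | h0
  · exact h0.trans hT.le
  refine le_exitTime (isBounded_openSimplex P) hv ((mem_openSimplex P).2 fun i => ?_)
  have hpos := (mem_openSimplex P).1 hx i
  have htA : t * A < 1 := by
    rwa [← one_div, lt_div_iff₀ hA] at ht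
  have h1 : t * |(bary P i).linear v| ≤ t * (A * bary P i x) :=
    mul_le_mul_of_nonneg_left (h i) h0.le
  rw [affineMap_add_smul]
  nlinarith [neg_abs_le ((bary P i).linear v)]

/-- If on the face of `C₂` spanned by the vertices `j` with `bary C₂ j s ≠ 0` the function
`bary C₁ i` vanishes as soon as it vanishes at the vertex `s` of `S`, then the Finsler metric of
`C₁` is dominated on `S` by that of `C₂`. -/
theorem exists_hilbertFinsler_le_mul (S C₁ C₂ : Affine.Simplex ℝ (EuclideanSpace ℝ (Fin n)) n)
    (hSC : closedSimplex S ⊆ closedSimplex C₁) (hCC : closedSimplex C₁ ⊆ closedSimplex C₂)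
    (h : ∀ m i j, bary C₁ i (S.points m) = 0 →
      bary C₁ i (C₂.points j) * bary C₂ j (S.points m) = 0) :
    ∃ M : ℝ, ∀ x ∈ closedSimplex S, x ∈ openSimplex C₁ → ∀ v : EuclideanSpace ℝ (Fin n),
      hilbertFinsler (openSimplex C₁) x v ≤ M * hilbertFinsler (openSimplex C₂) x v := by
  have hex : ∀ i j, ∃ K : ℝ, 0 ≤ K ∧ ∀ x ∈ closedSimplex S,
      |bary C₁ i (C₂.points j) * bary C₂ j x| ≤ K * bary C₁ i x := by
    intro i j
    simpa using exists_abs_le_mul S (bary C₁ i) (bary C₁ i (C₂.points j) • bary C₂ j)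
      (fun m => (mem_closedSimplex C₁).1 (hSC (points_mem_closedSimplex S m)) i)
      (fun m hm => by simpa using h m i j hm)
  choose K hK0 hK using hex
  have hKK : ∀ i, 0 ≤ ∑ j, K i j := fun i => Finset.sum_nonneg fun j _ => hK0 i j
  set L := ∑ i, ∑ j, K i j with hL
  have hL0 : 0 ≤ L := Finset.sum_nonneg fun i _ => hKK i
  -- Each inverse exit time from `C₁` is at most `(L + 1) * R`. The `2` comes from adding two of
  -- them, and the `+ 1` keeps the bound positive.
  refine ⟨2 * (L + 1), fun x hxS hx v => ?_⟩
  by_cases hv : v = 0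
  · simp [hilbertFinsler, hv]
  have hv' := neg_ne_zero.2 hv
  have hx2 : x ∈ openSimplex C₂ := interior_mono hCC hx
  have hr := inv_pos.2 (exitTime_pos (isBounded_openSimplex C₂) (isOpen_openSimplex C₂) hx2 hv)
  have hl := inv_pos.2 (exitTime_pos (isBounded_openSimplex C₂) (isOpen_openSimplex C₂) hx2 hv')
  rw [hilbertFinsler_eq (isBounded_openSimplex C₁) (isOpen_openSimplex C₁) hx hv,
    hilbertFinsler_eq (isBounded_openSimplex C₂) (isOpen_openSimplex C₂) hx2 hv]
  have hμ : ∀ j, |(bary C₂ j).linear v| ≤ bary C₂ j x *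
      ((exitTime (openSimplex C₂) x (-v))⁻¹ + (exitTime (openSimplex C₂) x v)⁻¹) := by
    intro j
    have h1 := neg_linear_bary_le hx2 hv j
    have h2 := neg_linear_bary_le hx2 hv' j
    have hpos := (mem_openSimplex C₂).1 hx2 j
    rw [map_neg, neg_neg] at h2
    have h3 := mul_pos hpos hr
    have h4 := mul_pos hpos hl
    rw [mul_add]
    exact abs_le.2 ⟨by linarith, by linarith⟩
  set R := (exitTime (openSimplex C₂) x (-v))⁻¹ + (exitTime (openSimplex C₂) x v)⁻¹ with hR
  have hR0 : 0 < R := add_pos hl hr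
  have hlin : ∀ i, |(bary C₁ i).linear v| ≤ (L + 1) * R * bary C₁ i x := by
    intro i
    have hpos := (mem_openSimplex C₁).1 hx i
    calc |(bary C₁ i).linear v|
        ≤ ∑ j, |(bary C₂ j).linear v * bary C₁ i (C₂.points j)| := by
          rw [linear_eq_sum_bary C₂ (bary C₁ i) v]
          exact Finset.abs_sum_le_sum_abs _ _
      _ ≤ ∑ j, K i j * (R * bary C₁ i x) := by
          refine Finset.sum_le_sum fun j _ => ?_
          have h1 := hK i j x hxS
          have hpos2 := (mem_openSimplex C₂).1 hx2 j
          rw [abs_mul, abs_of_pos hpos2] at h1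
          rw [abs_mul]
          calc |(bary C₂ j).linear v| * |bary C₁ i (C₂.points j)|
              ≤ bary C₂ j x * R * |bary C₁ i (C₂.points j)| :=
                mul_le_mul_of_nonneg_right (hμ j) (abs_nonneg _)
            _ = |bary C₁ i (C₂.points j)| * bary C₂ j x * R := by ring
            _ ≤ K i j * bary C₁ i x * R := mul_le_mul_of_nonneg_right h1 hR0.le
            _ = K i j * (R * bary C₁ i x) := by ring
      _ = (∑ j, K i j) * (R * bary C₁ i x) := by rw [Finset.sum_mul]
      _ ≤ (L + 1) * (R * bary C₁ i x) := by
          have h1 : ∑ j, K i j ≤ L :=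
            Finset.single_le_sum (f := fun i => ∑ j, K i j) (fun i _ => hKK i) (Finset.mem_univ i)
          exact mul_le_mul_of_nonneg_right (by linarith) (mul_pos hR0 hpos).le
      _ = (L + 1) * R * bary C₁ i x := by ring
  have hA : 0 < (L + 1) * R := by positivity
  have h1 := inv_exitTime_le hx hv hA hlin
  have h2 := inv_exitTime_le hx hv' hA (fun i => by rw [map_neg, abs_neg]; exact hlin i)
  linarith

end Simplex

end HilbertSimplex

theorem mainTheorem4 (n : ℕ)
    (S C₁ C₂ : Affine.Simplex ℝ (EuclideanSpace ℝ (Fin n)) n)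
    -- the three simplices are nested
    (hSC : HilbertSimplex.closedSimplex S ⊆ HilbertSimplex.closedSimplex C₁)
    (hCC : HilbertSimplex.closedSimplex C₁ ⊆ HilbertSimplex.closedSimplex C₂)
    -- a face `F k` of `S` in each dimension `k ≤ n - 1`
    (F : Fin n → Finset (Fin (n + 1)))
    (hF : ∀ k : Fin n, (F k).card = (k : ℕ) + 1)
    -- `F k` lies in a `k`-dimensional face of `C₁` and in a `k`-dimensional face of `C₂`
    (hF₁ : ∀ k : Fin n, ∃ J : Finset (Fin (n + 1)), J.card = (k : ℕ) + 1 ∧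
      HilbertSimplex.closedFace S (F k) ⊆ HilbertSimplex.closedFace C₁ J)
    (hF₂ : ∀ k : Fin n, ∃ J : Finset (Fin (n + 1)), J.card = (k : ℕ) + 1 ∧
      HilbertSimplex.closedFace S (F k) ⊆ HilbertSimplex.closedFace C₂ J)
    -- `S` and the boundary of `C₁` meet only along these faces
    (hmeet : ∀ J : Finset (Fin (n + 1)), J ≠ Finset.univ →
      HilbertSimplex.closedFace C₁ J ∩ HilbertSimplex.closedSimplex S = ∅ ∨
      ∃ k : Fin n, HilbertSimplex.closedFace C₁ J ∩ HilbertSimplex.closedSimplex S =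
        HilbertSimplex.closedFace S (F k)) :
    ∃ M : ℝ, ∀ x ∈ HilbertSimplex.closedSimplex S, x ∈ HilbertSimplex.openSimplex C₁ →
      ∀ v : EuclideanSpace ℝ (Fin n),
        HilbertSimplex.hilbertFinsler (HilbertSimplex.openSimplex C₂) x v ≤
            HilbertSimplex.hilbertFinsler (HilbertSimplex.openSimplex C₁) x v ∧
          HilbertSimplex.hilbertFinsler (HilbertSimplex.openSimplex C₁) x v ≤
            M * HilbertSimplex.hilbertFinsler (HilbertSimplex.openSimplex C₂) x v := by
  open HilbertSimplex in
  have hvanish : ∀ m i j, bary C₁ i (S.points m) = 0 →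
      bary C₁ i (C₂.points j) * bary C₂ j (S.points m) = 0 := by
    intro m i j hm
    have hmem : S.points m ∈ closedFace C₁ (Finset.univ.erase i) ∩ closedSimplex S :=
      ⟨mem_closedFace_erase C₁ (hSC (points_mem_closedSimplex S m)) hm,
        points_mem_closedSimplex S m⟩
    rcases hmeet (Finset.univ.erase i) (by simp) with h | ⟨k, hk⟩
    · exact absurd hmem (by rw [h]; exact Set.notMem_empty _)
    obtain ⟨J, hJ, hFJ⟩ := hF₂ k
    -- Either the vertex `j` of `C₂` lies in the flat of `F k`, killing the first factor, or its
    -- coordinate vanishes on `F k`, killing the second.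
    by_cases hj : j ∈ J
    · have hzero : ∀ y ∈ S.points '' (F k : Set (Fin (n + 1))), bary C₁ i y = 0 := fun y hy =>
        bary_eq_zero_of_mem_closedFace C₁ (Finset.notMem_erase i _)
          (hk.symm.subset (subset_convexHull ℝ _ hy)).1
      have hspan := affineSpan_face_eq S (hF k) hJ hFJ
      rw [affineMap_eq_zero_of_mem_affineSpan (bary C₁ i) hzero
        (hspan ▸ subset_affineSpan ℝ _ ⟨j, hj, rfl⟩), zero_mul]
    · rw [bary_eq_zero_of_mem_closedFace C₂ hj (hFJ (hk ▸ hmem)), mul_zero]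
  obtain ⟨M, hM⟩ := HilbertSimplex.exists_hilbertFinsler_le_mul S C₁ C₂ hSC hCC hvanish
  exact ⟨M, fun x hxS hx v =>
    ⟨HilbertSimplex.hilbertFinsler_anti (HilbertSimplex.isBounded_openSimplex C₁)
      (HilbertSimplex.isOpen_openSimplex C₁) (HilbertSimplex.isBounded_openSimplex C₂)
      (HilbertSimplex.isOpen_openSimplex C₂) (interior_mono hCC) hx, hM x hxS hx v⟩⟩
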